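/- Let $\ell\ge 0$ and $n\ge 0$ be integers, $V=\mathbb{C}^n$, $G=GL(V)$, and let $$T^*\overline R=\mathfrak{sl}(V)^{\oplus \ell}\oplus\mathfrak{sl}(V)^{\oplus \ell}\oplus V^*\oplus V$$ be the space of tuples $(X_1,\dots,X_\ell,Y_1,\dots,Y_\ell,i,j)$, with the $G$-action $g\cdot(X_k,Y_k,i,j)=(gX_kg^{-1},gY_kg^{-1},ig^{-1},gj)$ and the moment map $\mu(X,Y,i,j)=\sum_{k=1}^{\ell}[X_k,Y_k]-ji\in\mathfrak{gl}(V)$. Let $\theta=\det^{-1}$, and call $x\in\mu^{-1}(0)$ $\theta$-semistable if $f(x)\ne 0$ for some regular function $f$ on $\mu^{-1}(0)$ satisfying $f(g^{-1}x)=\theta(g)^m f(x)$ for all $g\in G$, $x\in\mu^{-1}(0)$ and some $m>0$. Let $\overline{\mathcal M}^\theta(n,\ell)=\mu^{-1}(0)^{\theta\text{-}ss}/\!/^{\theta}\,G$ be the GIT quotient; its points are the classes of semistable points, two semistable points being identified when the closures of their $G$-orbits meet in the semistable locus. This is the Nakajima quiver variety of the quiver with one vertex and $\ell$ loops, with one-dimensional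 framing (with traceless $X_k,Y_k$). The torus $T=(\mathbb{C}^*)^\ell$ acts on it by $t\cdot(X_k,Y_k,i,j)=(t_kX_k,t_k^{-1}Y_k,i,j)$. (1) If $\dim V=n\le 3$, then $\overline{\mathcal M}^\theta(n,\ell)$ has only finitely many $T$-fixed points. (2) For $n=2$ there are exactly $2\ell$ fixed points, namely the classes of the ($\theta$-semistable) tuples $p_s$ and $p_{s+\ell}$, $s\in\{1,\dots,\ell\}$, where $p_s$ has $X_s=\begin{pmatrix}0&0\\1&0\end{pmatrix}$, $j=\begin{pmatrix}1\\0\end{pmatrix}$ and all other components $0$, and $p_{s+\ell}$ has $Y_s=\begin{pmatrix}0&0\\1&0\end{pmatrix}$, $j=\begin{pmatrix}1\\0\end{pmatrix}$ and all other components $0$. -/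

import Mathlib

namespace BouquetQuiver

noncomputable section

open Matrix MvPolynomial

/-- The cotangent space `T^*R̄ = sl(V)^ℓ ⊕ sl(V)^ℓ ⊕ V^* ⊕ V` for `R̄ = sl(V)^ℓ ⊕ V^*` and `V = ℂⁿ`,
where `sl(V)` is identified with its dual by the trace form. The covector `i` is a row vector and
`j` is a column vector. -/
@[ext]
structure CotangentRep (n ℓ : ℕ) where
  X : Fin ℓ → Matrix (Fin n) (Fin n) ℂ
  Y : Fin ℓ → Matrix (Fin n) (Fin n) ℂ
  i : Fin n → ℂ
  j : Fin n → ℂ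
  trace_X : ∀ k, (X k).trace = 0
  trace_Y : ∀ k, (Y k).trace = 0

/-- The moment map `μ(X, Y, i, j) = ∑ₖ [Xₖ, Yₖ] - j i` for the action of `GL(V)`. -/
def momentMap {n ℓ : ℕ} (x : CotangentRep n ℓ) : Matrix (Fin n) (Fin n) ℂ :=
  ∑ k, (x.X k * x.Y k - x.Y k * x.X k) - vecMulVec x.j x.i

/-- `GL(V)` acts by `g • (X, Y, i, j) = (g X g⁻¹, g Y g⁻¹, i g⁻¹, g j)`. -/
instance glAction (n ℓ : ℕ) : MulAction (GL (Fin n) ℂ) (CotangentRep n ℓ) where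
  smul g x :=
    { X := fun k => (g : Matrix (Fin n) (Fin n) ℂ) * x.X k * (g⁻¹ : GL (Fin n) ℂ).val
      Y := fun k => (g : Matrix (Fin n) (Fin n) ℂ) * x.Y k * (g⁻¹ : GL (Fin n) ℂ).val
      i := x.i ᵥ* (g⁻¹ : GL (Fin n) ℂ).val
      j := (g : Matrix (Fin n) (Fin n) ℂ) *ᵥ x.j
      trace_X := fun k => by
        rw [trace_mul_comm, ← mul_assoc, Units.inv_mul, one_mul]; exact x.trace_X k
      trace_Y := fun k => by
        rw [trace_mul_comm, ← mul_assoc, Units.inv_mul, one_mul]; exact x.trace_Y k }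
  one_smul x := by
    ext1
    · funext k; change (1 : Matrix (Fin n) (Fin n) ℂ) * x.X k * _ = _; simp
    · funext k; change (1 : Matrix (Fin n) (Fin n) ℂ) * x.Y k * _ = _; simp
    · change x.i ᵥ* ((1 : GL (Fin n) ℂ)⁻¹ : GL (Fin n) ℂ).val = _; simp
    · change (1 : Matrix (Fin n) (Fin n) ℂ) *ᵥ x.j = _; simp
  mul_smul g h x := by
    ext1
    · funext k
      change ((g * h : GL (Fin n) ℂ) : Matrix (Fin n) (Fin n) ℂ) * x.X k *
        ((g * h)⁻¹ : GL (Fin n) ℂ).val = g.val * (h.val * x.X k * (h⁻¹).val) * (g⁻¹).val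
      rw [_root_.mul_inv_rev, Units.val_mul, Units.val_mul]; simp only [mul_assoc]
    · funext k
      change ((g * h : GL (Fin n) ℂ) : Matrix (Fin n) (Fin n) ℂ) * x.Y k *
        ((g * h)⁻¹ : GL (Fin n) ℂ).val = g.val * (h.val * x.Y k * (h⁻¹).val) * (g⁻¹).val
      rw [_root_.mul_inv_rev, Units.val_mul, Units.val_mul]; simp only [mul_assoc]
    · change x.i ᵥ* ((g * h)⁻¹ : GL (Fin n) ℂ).val = (x.i ᵥ* (h⁻¹).val) ᵥ* (g⁻¹).val
      rw [_root_.mul_inv_rev, Units.val_mul, vecMul_vecMul]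
    · change ((g * h : GL (Fin n) ℂ) : Matrix (Fin n) (Fin n) ℂ) *ᵥ x.j = g.val *ᵥ (h.val *ᵥ x.j)
      rw [Units.val_mul, mulVec_mulVec]

/-- The torus `T = (ℂ^*)^ℓ`. -/
abbrev Torus (ℓ : ℕ) : Type := Fin ℓ → ℂˣ

/-- The action of `T` on `T^*R̄` induced by rescaling `X₁, …, X_ℓ`:
`t • (X, Y, i, j) = (tₖ Xₖ, tₖ⁻¹ Yₖ, i, j)`. -/
instance torusAction (n ℓ : ℕ) : MulAction (Torus ℓ) (CotangentRep n ℓ) where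
  smul t x :=
    { X := fun k => (t k : ℂ) • x.X k
      Y := fun k => ((t k)⁻¹ : ℂˣ).val • x.Y k
      i := x.i
      j := x.j
      trace_X := fun k => by rw [trace_smul, x.trace_X k, smul_zero]
      trace_Y := fun k => by rw [trace_smul, x.trace_Y k, smul_zero] }
  one_smul x := by
    ext1
    · funext k; change ((1 : ℂˣ) : ℂ) • x.X k = _; simp
    · funext k; change ((1 : ℂˣ)⁻¹ : ℂˣ).val • x.Y k = _; simp
    · rfl
    · rfl
  mul_smul s t x := by
    ext1
    · funext k
      change ((s k * t k : ℂˣ) : ℂ) • x.X k = (s k : ℂ) • ((t k : ℂ) • x.X k)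
      rw [Units.val_mul, smul_smul]
    · funext k
      change ((s k * t k)⁻¹ : ℂˣ).val • x.Y k = ((s k)⁻¹ : ℂˣ).val • (((t k)⁻¹ : ℂˣ).val • x.Y k)
      rw [mul_inv, Units.val_mul, smul_smul]
    · rfl
    · rfl

theorem torus_gl_comm {n ℓ : ℕ} (t : Torus ℓ) (g : GL (Fin n) ℂ) (x : CotangentRep n ℓ) :
    t • g • x = g • t • x := by
  ext1
  · funext k
    change (t k : ℂ) • (g.val * x.X k * (g⁻¹).val) = g.val * ((t k : ℂ) • x.X k) * (g⁻¹).val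
    rw [mul_smul_comm, smul_mul_assoc]
  · funext k
    change ((t k)⁻¹ : ℂˣ).val • (g.val * x.Y k * (g⁻¹).val) =
      g.val * (((t k)⁻¹ : ℂˣ).val • x.Y k) * (g⁻¹).val
    rw [mul_smul_comm, smul_mul_assoc]
  · rfl
  · rfl

theorem momentMap_torus {n ℓ : ℕ} (t : Torus ℓ) (x : CotangentRep n ℓ) :
    momentMap (t • x) = momentMap x := by
  change ∑ k, (((t k : ℂ) • x.X k) * (((t k)⁻¹ : ℂˣ).val • x.Y k) -
    (((t k)⁻¹ : ℂˣ).val • x.Y k) * ((t k : ℂ) • x.X k)) - vecMulVec x.j x.i = _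
  simp [momentMap, smul_smul]

/-- Labels of the matrix entries of `X`, of `Y`, and of the entries of `i` and `j`. -/
abbrev Coord (n ℓ : ℕ) : Type :=
  (Fin ℓ × Fin n × Fin n) ⊕ (Fin ℓ × Fin n × Fin n) ⊕ Fin n ⊕ Fin n

/-- The coordinates of a point of `T^*R̄`. -/
def coord {n ℓ : ℕ} (x : CotangentRep n ℓ) : Coord n ℓ → ℂ
  | .inl (k, a, b) => x.X k a b
  | .inr (.inl (k, a, b)) => x.Y k a b
  | .inr (.inr (.inl a)) => x.i a
  | .inr (.inr (.inr a)) => x.j a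

/-- The value at `x` of the regular function on `T^*R̄` given by a polynomial in the entries. -/
def value {n ℓ : ℕ} (f : MvPolynomial (Coord n ℓ) ℂ) (x : CotangentRep n ℓ) : ℂ :=
  eval (coord x) f

/-- The function `f` restricted to `μ⁻¹(0)` lies in `ℂ[μ⁻¹(0)]^{G, χ}`: it has weight `χ` for the
natural action `(g • f)(x) = f(g⁻¹ • x)` of `G = GL(V)` on functions. -/
def IsSemiInvariant {n ℓ : ℕ} (χ : GL (Fin n) ℂ →* ℂˣ) (f : MvPolynomial (Coord n ℓ) ℂ) : Prop :=
  ∀ (g : GL (Fin n) ℂ) (x : CotangentRep n ℓ), momentMap x = 0 →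
    value f (g⁻¹ • x) = (χ g : ℂ) * value f x

/-- The `θ`-semistable locus `μ⁻¹(0)^{θ-ss}`: the points of `μ⁻¹(0)` at which some semi-invariant
function of weight `θᵐ`, `m > 0`, does not vanish. -/
def semistableLocus (n ℓ : ℕ) (θ : GL (Fin n) ℂ →* ℂˣ) : Set (CotangentRep n ℓ) :=
  {x | momentMap x = 0 ∧ ∃ m : ℕ, 0 < m ∧ ∃ f : MvPolynomial (Coord n ℓ) ℂ,
    IsSemiInvariant (θ ^ m) f ∧ value f x ≠ 0}

/-- The Zariski closure in `T^*R̄` of the `GL(V)`-orbit of `x`. -/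
def orbitClosure {n ℓ : ℕ} (x : CotangentRep n ℓ) : Set (CotangentRep n ℓ) :=
  {y | ∀ f : MvPolynomial (Coord n ℓ) ℂ, (∀ g : GL (Fin n) ℂ, value f (g • x) = 0) → value f y = 0}

/-- Two semistable points have the same image in the GIT quotient when the closures of their orbits
meet in the semistable locus. -/
def GITRel (n ℓ : ℕ) (θ : GL (Fin n) ℂ →* ℂˣ) (x y : semistableLocus n ℓ θ) : Prop :=
  ∃ z ∈ semistableLocus n ℓ θ, z ∈ orbitClosure (x : CotangentRep n ℓ) ∧
    z ∈ orbitClosure (y : CotangentRep n ℓ)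

/-- The (closed) points of the GIT quotient `μ⁻¹(0)^{θ-ss} //^θ GL(V)`: the quotient of the
semistable locus by the relation `GITRel`. -/
def QuiverVariety (n ℓ : ℕ) (θ : GL (Fin n) ℂ →* ℂˣ) : Type :=
  Quot (GITRel n ℓ θ)

/-- The point of the GIT quotient represented by a semistable point. -/
def QuiverVariety.mk {n ℓ : ℕ} {θ : GL (Fin n) ℂ →* ℂˣ} (x : CotangentRep n ℓ)
    (hx : x ∈ semistableLocus n ℓ θ) : QuiverVariety n ℓ θ :=
  Quot.mk _ ⟨x, hx⟩

/-- The weight by which `t` multiplies each coordinate. -/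
def coordWeight {n ℓ : ℕ} (t : Torus ℓ) : Coord n ℓ → ℂ
  | .inl (k, _, _) => t k
  | .inr (.inl (k, _, _)) => ((t k)⁻¹ : ℂˣ)
  | .inr (.inr _) => 1

theorem exists_value_torus {n ℓ : ℕ} (t : Torus ℓ) (f : MvPolynomial (Coord n ℓ) ℂ) :
    ∃ f' : MvPolynomial (Coord n ℓ) ℂ, ∀ x, value f' x = value f (t • x) := by
  refine ⟨bind₁ (fun c => C (coordWeight t c) * MvPolynomial.X c) f, fun x => ?_⟩
  have h : coord (t • x) = fun c => coordWeight t c * coord x c := by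
    funext c
    rcases c with ⟨k, a, b⟩ | ⟨k, a, b⟩ | a | a
    · rfl
    · rfl
    · exact (one_mul _).symm
    · exact (one_mul _).symm
  simp only [value, h]
  rw [← coe_aeval_eq_eval, RingHom.coe_coe, aeval_bind₁, ← coe_aeval_eq_eval, RingHom.coe_coe]
  simp

theorem torus_mem_semistableLocus {n ℓ : ℕ} {θ : GL (Fin n) ℂ →* ℂˣ} (t : Torus ℓ)
    {x : CotangentRep n ℓ} (hx : x ∈ semistableLocus n ℓ θ) : t • x ∈ semistableLocus n ℓ θ := by
  obtain ⟨h0, m, hm, f, hf, hfx⟩ := hx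
  obtain ⟨f', hf'⟩ := exists_value_torus t⁻¹ f
  refine ⟨by rw [momentMap_torus, h0], m, hm, f', fun g y hy => ?_, ?_⟩
  · rw [hf', hf', torus_gl_comm]
    exact hf g _ (by rw [momentMap_torus, hy])
  · rw [hf', inv_smul_smul]
    exact hfx

theorem torus_mem_orbitClosure {n ℓ : ℕ} (t : Torus ℓ) {x y : CotangentRep n ℓ}
    (h : y ∈ orbitClosure x) : t • y ∈ orbitClosure (t • x) := by
  intro f hf
  obtain ⟨f', hf'⟩ := exists_value_torus t f
  rw [← hf']
  refine h f' fun g => ?_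
  rw [hf', torus_gl_comm]
  exact hf g

/-- The action of `T` on `T^*R̄` descends to the GIT quotient. -/
instance quiverVarietyAction (n ℓ : ℕ) (θ : GL (Fin n) ℂ →* ℂˣ) :
    MulAction (Torus ℓ) (QuiverVariety n ℓ θ) where
  smul t := Quot.map (fun x => ⟨t • x.1, torus_mem_semistableLocus t x.2⟩)
    fun _ _ ⟨z, hz, hx, hy⟩ => ⟨t • z, torus_mem_semistableLocus t hz,
      torus_mem_orbitClosure t hx, torus_mem_orbitClosure t hy⟩
  one_smul p := by
    induction p using Quot.ind with
    | mk x => exact congrArg (Quot.mk _) (Subtype.ext (one_smul (Torus ℓ) x.1))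
  mul_smul s t p := by
    induction p using Quot.ind with
    | mk x => exact congrArg (Quot.mk _) (Subtype.ext (mul_smul s t x.1))

/-- The character `det⁻¹` of `GL(V)`. -/
def detInv (n : ℕ) : GL (Fin n) ℂ →* ℂˣ := (Matrix.GeneralLinearGroup.det)⁻¹

/-- The Nakajima quiver variety `M̄^θ(n, ℓ)` with `θ = det⁻¹`. -/
abbrev NakajimaVariety (n ℓ : ℕ) : Type := QuiverVariety n ℓ (detInv n)

/-- The point with `X_s = E₂₁`, `j = e₁`, and all other components zero. -/
def pointX {ℓ : ℕ} (s : Fin ℓ) : CotangentRep 2 ℓ where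
  X := fun k => if k = s then !![0, 0; 1, 0] else 0
  Y := fun _ => 0
  i := 0
  j := ![1, 0]
  trace_X := fun k => by split_ifs <;> simp [trace_fin_two]
  trace_Y := fun k => by simp

/-- The point with `Y_s = E₂₁`, `j = e₁`, and all other components zero. -/
def pointY {ℓ : ℕ} (s : Fin ℓ) : CotangentRep 2 ℓ where
  X := fun _ => 0
  Y := fun k => if k = s then !![0, 0; 1, 0] else 0
  i := 0
  j := ![1, 0]
  trace_X := fun k => by simp
  trace_Y := fun k => by split_ifs <;> simp [trace_fin_two]

end

end BouquetQuiver

namespace BouquetQuiver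

open Matrix

/-! A semistable point is cyclic: the words in the `Xₖ` and `Yₖ` applied to `j` span `V`
(`eq_top_of_mem_semistableLocus`). Coordinates in a basis of word vectors are regular functions
divided by a determinant, so orbits are closed in the semistable locus and the points of the
quotient are orbits (`mk_eq_mk_iff`). Growing a basis from `j` one letter at a time produces a
rooted tree whose edges carry letters (`exists_isAdapted`).

If the class is fixed by `T`, each `t` acts on the point as some `g`, and in the adapted basis `g`
must be diagonal. Each basis vector thus gets a weight, the product of the letter characters on its
path from the root, and an entry can be nonzero only if the weights at its two ends differ by the
character of its letter (`IsAdapted.weight_eq`). At `t = -1` every letter has character `-1`, so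
nonzero entries join vertices of opposite parity. In a tree with at most three vertices, two
distinct vertices not joined by an edge have equal parity; hence all nonzero entries lie along tree
edges, in one direction or the other.

The diagonal part of `μ = 0` is a conservation law: an antisymmetric flow on the tree with no source
away from the root. Such a flow vanishes, which kills every entry running against an edge. The point
is then determined by its labelled tree, and there are finitely many of these. For `n = 2` the tree
is a single edge with one of `2ℓ` letters. -/

/-- Labels of the matrices `X₁, …, X_ℓ` (left) and `Y₁, …, Y_ℓ` (right). -/
abbrev Letter (ℓ : ℕ) : Type := Fin ℓ ⊕ Fin ℓ

/-! ### Letters, words, and the two group actions. -/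

section Letters

variable {n ℓ : ℕ}

/-- The matrix of `x` with a given label. -/
def mat (x : CotangentRep n ℓ) : Letter ℓ → Matrix (Fin n) (Fin n) ℂ := Sum.elim x.X x.Y

theorem ext_mat {x y : CotangentRep n ℓ} (h : ∀ c, mat x c = mat y c) (hi : x.i = y.i)
    (hj : x.j = y.j) : x = y :=
  CotangentRep.ext (funext fun k => h (.inl k)) (funext fun k => h (.inr k)) hi hj

theorem mat_gl (g : GL (Fin n) ℂ) (x : CotangentRep n ℓ) (c : Letter ℓ) :
    mat (g • x) c = g.val * mat x c * (g⁻¹).val := by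
  cases c <;> rfl

theorem j_gl (g : GL (Fin n) ℂ) (x : CotangentRep n ℓ) : (g • x).j = g.val *ᵥ x.j := rfl

theorem i_gl (g : GL (Fin n) ℂ) (x : CotangentRep n ℓ) : (g • x).i = x.i ᵥ* (g⁻¹).val := rfl

/-- The character of the torus by which it rescales the matrix with label `c`. -/
def letterChar (c : Letter ℓ) (t : Torus ℓ) : ℂˣ :=
  Sum.elim (fun k => t k) (fun k => (t k)⁻¹) c

theorem mat_torus (t : Torus ℓ) (x : CotangentRep n ℓ) (c : Letter ℓ) :
    mat (t • x) c = (letterChar c t : ℂ) • mat x c := by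
  cases c <;> rfl

theorem letterChar_injective : Function.Injective (letterChar (ℓ := ℓ)) := by
  have h2 : (2 : ℂ) ≠ 0 := two_ne_zero
  intro c d h
  -- With `2` in slot `k` and `1` elsewhere, a letter takes the value `2`, `1/2` or `1`, which tells
  -- it apart from all others as `k` varies.
  have key : ∀ k : Fin ℓ, letterChar c (Pi.mulSingle k (Units.mk0 2 h2)) =
      letterChar d (Pi.mulSingle k (Units.mk0 2 h2)) := fun k => congrFun h _
  rcases c with k | k <;> rcases d with m | m <;> have hk := key k <;>
    by_cases hkm : m = k <;>
    simp [letterChar, Pi.mulSingle_apply, hkm, Units.ext_iff] at hk ⊢ <;>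
    norm_num at hk

theorem letterChar_swap (c : Letter ℓ) : letterChar c.swap = (letterChar c)⁻¹ := by
  funext t
  cases c <;> simp [letterChar]

/-- This is the source of the parity argument: one torus element changes the sign of all matrices at
once. -/
theorem letterChar_neg_one (c : Letter ℓ) : letterChar c (-1) = -1 := by
  cases c <;> simp [letterChar]

/-- The sign with which the label `c` enters the moment map. -/
def letterSign (c : Letter ℓ) : ℂ := Sum.elim (fun _ => 1) (fun _ => -1) c

theorem letterSign_swap (c : Letter ℓ) : letterSign c.swap = -letterSign c := by
  cases c <;> simp [letterSign]

theorem letterSign_ne_zero (c : Letter ℓ) : letterSign c ≠ 0 := by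
  cases c <;> simp [letterSign]

theorem momentMap_eq (x : CotangentRep n ℓ) :
    momentMap x = ∑ c, letterSign c • (mat x c * mat x c.swap) - vecMulVec x.j x.i := by
  simp [momentMap, Fintype.sum_sum_type, letterSign, mat, Finset.sum_add_distrib, sub_eq_add_neg]

theorem momentMap_gl (g : GL (Fin n) ℂ) (x : CotangentRep n ℓ) :
    momentMap (g • x) = g.val * momentMap x * (g⁻¹).val := by
  rw [momentMap_eq, momentMap_eq, mul_sub, sub_mul, Finset.mul_sum, Finset.sum_mul]
  congr 1
  · refine Finset.sum_congr rfl fun c _ => ?_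
    rw [mat_gl, mat_gl, mul_smul_comm, smul_mul_assoc]
    congr 1
    simp only [mul_assoc]
    rw [← mul_assoc (g⁻¹).val g.val, Units.inv_mul, one_mul]
  · rw [j_gl, i_gl, mul_vecMulVec, vecMulVec_mul]

/-- The vector obtained from `j` by applying the matrices of a word. -/
def wordVec (x : CotangentRep n ℓ) : List (Letter ℓ) → Fin n → ℂ
  | [] => x.j
  | c :: w => mat x c *ᵥ wordVec x w

theorem wordVec_gl (g : GL (Fin n) ℂ) (x : CotangentRep n ℓ) (w : List (Letter ℓ)) :
    wordVec (g • x) w = g.val *ᵥ wordVec x w := by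
  induction w with
  | nil => rfl
  | cons c w ih =>
    rw [wordVec, wordVec, ih, mat_gl, mulVec_mulVec, mulVec_mulVec, mul_assoc, mul_assoc,
      Units.inv_mul, mul_one]

/-- The matrix whose columns are the vectors of the given words. -/
def wordMatrix (w : Fin n → List (Letter ℓ)) (x : CotangentRep n ℓ) : Matrix (Fin n) (Fin n) ℂ :=
  Matrix.of fun a b => wordVec x (w b) a

theorem wordMatrix_gl (w : Fin n → List (Letter ℓ)) (g : GL (Fin n) ℂ) (x : CotangentRep n ℓ) :
    wordMatrix w (g • x) = g.val * wordMatrix w x := by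
  ext a b
  simp [wordMatrix, wordVec_gl, mul_apply, mulVec, dotProduct]

/-! ### Regular functions and orbit closures. -/

/-- The algebra of regular functions on `T^*R̄`. -/
noncomputable def regularFunctions (n ℓ : ℕ) : Subalgebra ℂ (CotangentRep n ℓ → ℂ) :=
  (AlgHom.pi fun x : CotangentRep n ℓ => MvPolynomial.aeval (coord x)).range

theorem mem_regularFunctions {F : CotangentRep n ℓ → ℂ} :
    F ∈ regularFunctions n ℓ ↔ ∃ f, ∀ x, value f x = F x := by
  simp only [regularFunctions, AlgHom.mem_range, funext_iff]
  rfl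

theorem coord_regular (a : Coord n ℓ) : (fun x => coord x a) ∈ regularFunctions n ℓ :=
  mem_regularFunctions.2 ⟨MvPolynomial.X a, fun x => by simp [value]⟩

theorem i_regular (a : Fin n) : (fun x => x.i a) ∈ regularFunctions n ℓ :=
  coord_regular (.inr (.inr (.inl a)))

theorem j_regular (a : Fin n) : (fun x => x.j a) ∈ regularFunctions n ℓ :=
  coord_regular (.inr (.inr (.inr a)))

theorem mat_regular (c : Letter ℓ) (a b : Fin n) : (fun x => mat x c a b) ∈ regularFunctions n ℓ :=
  match c with
  | .inl k => coord_regular (.inl (k, a, b))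
  | .inr k => coord_regular (.inr (.inl (k, a, b)))

theorem const_regular (z : ℂ) : (fun _ => z) ∈ regularFunctions n ℓ :=
  Subalgebra.algebraMap_mem _ z

theorem sum_regular {ι : Type*} (s : Finset ι) {F : ι → CotangentRep n ℓ → ℂ}
    (h : ∀ i ∈ s, F i ∈ regularFunctions n ℓ) :
    (fun x => ∑ i ∈ s, F i x) ∈ regularFunctions n ℓ := by
  have := Subalgebra.sum_mem _ h
  rwa [show ∑ i ∈ s, F i = fun x => ∑ i ∈ s, F i x from funext fun x => by simp] at this

theorem mul_regular {F H : CotangentRep n ℓ → ℂ} (hF : F ∈ regularFunctions n ℓ)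
    (hH : H ∈ regularFunctions n ℓ) : (fun x => F x * H x) ∈ regularFunctions n ℓ :=
  Subalgebra.mul_mem _ hF hH

theorem mul_matrix_regular {m : ℕ} {A B : CotangentRep n ℓ → Matrix (Fin m) (Fin m) ℂ}
    (hA : ∀ a b, (fun x => A x a b) ∈ regularFunctions n ℓ)
    (hB : ∀ a b, (fun x => B x a b) ∈ regularFunctions n ℓ) (a b : Fin m) :
    (fun x => (A x * B x) a b) ∈ regularFunctions n ℓ := by
  simp only [mul_apply]
  exact sum_regular _ fun k _ => mul_regular (hA a k) (hB k b)

theorem mulVec_regular {m : ℕ} {A : CotangentRep n ℓ → Matrix (Fin m) (Fin m) ℂ}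
    {v : CotangentRep n ℓ → Fin m → ℂ} (hA : ∀ a b, (fun x => A x a b) ∈ regularFunctions n ℓ)
    (hv : ∀ a, (fun x => v x a) ∈ regularFunctions n ℓ) (a : Fin m) :
    (fun x => (A x *ᵥ v x) a) ∈ regularFunctions n ℓ := by
  simp only [mulVec, dotProduct]
  exact sum_regular _ fun k _ => mul_regular (hA a k) (hv k)

theorem det_regular {m : ℕ} {A : CotangentRep n ℓ → Matrix (Fin m) (Fin m) ℂ}
    (hA : ∀ a b, (fun x => A x a b) ∈ regularFunctions n ℓ) :
    (fun x => (A x).det) ∈ regularFunctions n ℓ := by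
  simp only [det_apply']
  refine sum_regular _ fun σ _ => mul_regular (const_regular _) ?_
  have := Subalgebra.prod_mem (regularFunctions n ℓ) (t := Finset.univ)
    fun i (_ : i ∈ Finset.univ) => hA (σ i) i
  rwa [show ∏ i, (fun x => A x (σ i) i) = fun x => ∏ i, A x (σ i) i from
    funext fun x => by simp] at this

theorem adjugate_regular {m : ℕ} {A : CotangentRep n ℓ → Matrix (Fin m) (Fin m) ℂ}
    (hA : ∀ a b, (fun x => A x a b) ∈ regularFunctions n ℓ) (a b : Fin m) :
    (fun x => (A x).adjugate a b) ∈ regularFunctions n ℓ := by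
  simp only [adjugate_apply]
  refine det_regular fun r s => ?_
  by_cases h : r = b
  · subst h
    simpa using const_regular _
  · simpa [updateRow_apply, h] using hA r s

theorem wordVec_regular (w : List (Letter ℓ)) (a : Fin n) :
    (fun x => wordVec x w a) ∈ regularFunctions n ℓ := by
  induction w generalizing a with
  | nil => exact j_regular a
  | cons c w ih => exact mulVec_regular (mat_regular c) ih a

theorem wordMatrix_regular (w : Fin n → List (Letter ℓ)) (a b : Fin n) :
    (fun x => wordMatrix w x a b) ∈ regularFunctions n ℓ :=
  wordVec_regular (w b) a

/-- Regular functions that vanish on an orbit vanish on its closure. -/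
theorem eq_of_mem_orbitClosure {x z : CotangentRep n ℓ} (hz : z ∈ orbitClosure x)
    {F H : CotangentRep n ℓ → ℂ} (hF : F ∈ regularFunctions n ℓ) (hH : H ∈ regularFunctions n ℓ)
    (h : ∀ g : GL (Fin n) ℂ, F (g • x) = H (g • x)) : F z = H z := by
  obtain ⟨f, hf⟩ := mem_regularFunctions.1 (Subalgebra.sub_mem _ hF hH)
  have := hz f fun g => by rw [hf, Pi.sub_apply, h g, sub_self]
  rwa [hf, Pi.sub_apply, sub_eq_zero] at this

/-- A point of `μ⁻¹(0)` at which `n` words give a basis is semistable. -/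
theorem mem_semistableLocus_of_det_ne_zero {x : CotangentRep n ℓ} (h0 : momentMap x = 0)
    (w : Fin n → List (Letter ℓ)) (hw : (wordMatrix w x).det ≠ 0) :
    x ∈ semistableLocus n ℓ (detInv n) := by
  obtain ⟨f, hf⟩ := mem_regularFunctions.1 (det_regular (wordMatrix_regular (ℓ := ℓ) w))
  -- The word matrix is multiplied by `g` on the left, so its determinant already has weight `θ` and
  -- `m = 1` suffices.
  refine ⟨h0, 1, one_pos, f, fun g y _ => ?_, by rwa [hf]⟩
  rw [hf, hf, wordMatrix_gl, det_mul, MonoidHom.pow_apply, pow_one, detInv, MonoidHom.inv_apply, ← map_inv]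
  rfl

theorem gl_mem_semistableLocus {θ : GL (Fin n) ℂ →* ℂˣ} {x : CotangentRep n ℓ}
    (hx : x ∈ semistableLocus n ℓ θ) (g : GL (Fin n) ℂ) : g • x ∈ semistableLocus n ℓ θ := by
  obtain ⟨h0, m, hm, f, hf, hfx⟩ := hx
  refine ⟨by rw [momentMap_gl, h0, mul_zero, zero_mul], m, hm, f, hf, ?_⟩
  have := hf g⁻¹ x h0
  rw [inv_inv] at this
  rw [this]
  exact mul_ne_zero (Units.ne_zero _) hfx

theorem gl_mem_orbitClosure (x : CotangentRep n ℓ) (g : GL (Fin n) ℂ) : g • x ∈ orbitClosure x :=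
  fun _ hf => hf g

end Letters

/-! ### Semistability as cyclicity, and points of the quotient as orbits. -/

section Stability

variable {n ℓ : ℕ}

/-- The coordinates of the degeneration `(P + uQ)⁻¹ • x`, for `P` a projection to an invariant
subspace and `Q = 1 - P`, extended to `u = 0`. -/
def degenerationCoord (P Q : Matrix (Fin n) (Fin n) ℂ) (x : CotangentRep n ℓ) (u : ℂ) :
    Coord n ℓ → ℂ
  | .inl (k, a, b) => (P * x.X k * P + Q * x.X k * Q + u • (P * x.X k * Q)) a b
  | .inr (.inl (k, a, b)) => (P * x.Y k * P + Q * x.Y k * Q + u • (P * x.Y k * Q)) a b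
  | .inr (.inr (.inl a)) => (x.i ᵥ* (P + u • Q)) a
  | .inr (.inr (.inr a)) => x.j a

theorem continuous_degenerationCoord (P Q : Matrix (Fin n) (Fin n) ℂ) (x : CotangentRep n ℓ) :
    Continuous (degenerationCoord P Q x) := by
  refine continuous_pi fun c => ?_
  rcases c with ⟨k, a, b⟩ | ⟨k, a, b⟩ | a | a
  · simp only [degenerationCoord, Matrix.add_apply, Matrix.smul_apply]
    fun_prop
  · simp only [degenerationCoord, Matrix.add_apply, Matrix.smul_apply]
    fun_prop
  · simp only [degenerationCoord, vecMul_add, vecMul_smul, Pi.add_apply, Pi.smul_apply]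
    fun_prop
  · exact continuous_const

/-- A semistable point is cyclic: `j` lies in no proper invariant subspace. -/
theorem eq_top_of_mem_semistableLocus {x : CotangentRep n ℓ}
    (hx : x ∈ semistableLocus n ℓ (detInv n)) (W : Submodule ℂ (Fin n → ℂ)) (hj : x.j ∈ W)
    (hW : ∀ c, ∀ v ∈ W, mat x c *ᵥ v ∈ W) : W = ⊤ := by
  by_contra hne
  obtain ⟨h0, m, hm, f, hf, hfx⟩ := hx
  obtain ⟨r, hr⟩ := LinearMap.exists_leftInverse_of_injective W.subtype W.ker_subtype
  set P : Matrix (Fin n) (Fin n) ℂ := LinearMap.toMatrix' (W.subtype ∘ₗ r) with hP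
  have hPv : ∀ v, P *ᵥ v = (r v : Fin n → ℂ) := fun v => by
    rw [hP, LinearMap.toMatrix'_mulVec]; rfl
  have hPmem : ∀ v, P *ᵥ v ∈ W := fun v => by rw [hPv]; exact (r v).2
  have hPid : ∀ v ∈ W, P *ᵥ v = v := fun v hv => by
    rw [hPv]
    exact congrArg Subtype.val (LinearMap.congr_fun hr ⟨v, hv⟩)
  have hPP : P * P = P := ext_of_mulVec_single fun b => by
    rw [← mulVec_mulVec]; exact hPid _ (hPmem _)
  have hPM : ∀ c, P * (mat x c * P) = mat x c * P := fun c => ext_of_mulVec_single fun b => by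
    rw [← mulVec_mulVec]
    refine hPid _ ?_
    rw [← mulVec_mulVec]
    exact hW c _ (hPmem _)
  have hdet : P.det = 0 := by
    by_contra hd
    have hu : IsUnit P := (isUnit_iff_isUnit_det P).2 (isUnit_iff_ne_zero.2 hd)
    have h1 : P = 1 := hu.mul_left_cancel (by rw [hPP, mul_one])
    refine hne (eq_top_iff.2 fun v _ => ?_)
    have := hPmem v
    rwa [h1, one_mulVec] at this
  set Q : Matrix (Fin n) (Fin n) ℂ := 1 - P with hQ
  have hPQ : P * Q = 0 := by rw [hQ, mul_sub, mul_one, hPP, sub_self]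
  have hQP : Q * P = 0 := by rw [hQ, sub_mul, one_mul, hPP, sub_self]
  have hQQ : Q * Q = Q := by rw [hQ, sub_mul, one_mul, ← hQ, hPQ, sub_zero]
  have hadd : P + Q = 1 := add_sub_cancel _ _
  -- Invariance of `W` removes the only term of the conjugated matrices that would carry `u⁻¹`, so
  -- the degeneration extends to `u = 0`.
  have hQM : ∀ c, Q * mat x c * P = 0 := fun c => by
    rw [mul_assoc, hQ, sub_mul, one_mul, hPM, sub_self]
  have hinv : ∀ u : ℂ, u ≠ 0 → (P + u • Q) * (P + u⁻¹ • Q) = 1 := fun u hu => by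
    simp only [mul_add, add_mul, smul_mul_assoc, mul_smul_comm, hPP, hPQ, hQP, hQQ, smul_smul,
      inv_mul_cancel₀ hu, smul_zero, one_smul, zero_add, add_zero, hadd]
  -- For `u ≠ 0` this is semi-invariance under `P + u • Q`; continuity carries it to `u = 0`, where
  -- the determinant is `det P = 0` and hence `f` vanishes at `x`.
  have hconst : (fun u : ℂ => (P + u • Q).det ^ m * MvPolynomial.eval (degenerationCoord P Q x u) f)
      = fun _ => value f x := by
    refine Continuous.ext_on (dense_compl_singleton (0 : ℂ)) ?_ continuous_const fun u hu => ?_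
    · have h1 : Continuous fun u : ℂ => (P + u • Q).det := by fun_prop
      exact (h1.pow m).mul
        ((MvPolynomial.continuous_eval f).comp (continuous_degenerationCoord P Q x))
    · have hu : u ≠ 0 := hu
      have hinv' : (P + u⁻¹ • Q) * (P + u • Q) = 1 := by
        simpa using hinv u⁻¹ (inv_ne_zero hu)
      let g : GL (Fin n) ℂ := ⟨P + u • Q, P + u⁻¹ • Q, hinv u hu, hinv'⟩
      have hmat : ∀ c, (P + u⁻¹ • Q) * mat x c * (P + u • Q) =
          P * mat x c * P + Q * mat x c * Q + u • (P * mat x c * Q) := fun c => by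
        simp only [add_mul, mul_add, smul_mul_assoc, mul_smul_comm, hQM, smul_zero, smul_add,
          smul_inv_smul₀ hu]
        abel
      have hc : coord (g⁻¹ • x) = degenerationCoord P Q x u := by
        funext c
        rcases c with ⟨k, a, b⟩ | ⟨k, a, b⟩ | a | a
        · exact congrFun (congrFun (hmat (.inl k)) a) b
        · exact congrFun (congrFun (hmat (.inr k)) a) b
        · rfl
        · change ((P + u⁻¹ • Q) *ᵥ x.j) a = x.j a
          rw [add_mulVec, smul_mulVec, hQ, sub_mulVec, one_mulVec, hPid _ hj, sub_self, smul_zero,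
            add_zero]
      have key := hf g x h0
      rw [MonoidHom.pow_apply, detInv, MonoidHom.inv_apply] at key
      change (P + u • Q).det ^ m * _ = _
      rw [← hc]
      change _ * value f (g⁻¹ • x) = _
      rw [key]
      have hd : (P + u • Q).det = ((GeneralLinearGroup.det g : ℂˣ) : ℂ) := rfl
      rw [hd, ← mul_assoc, ← Units.val_pow_eq_pow_val, ← Units.val_mul, ← mul_pow,
        mul_inv_cancel, one_pow, Units.val_one, one_mul]
  refine hfx ?_
  have := congrFun hconst 0
  simp only [zero_smul, add_zero, hdet, zero_pow hm.ne', zero_mul] at this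
  exact this.symm

/-- At a semistable point some `n` words give a basis. -/
theorem exists_det_wordMatrix_ne_zero {x : CotangentRep n ℓ}
    (hx : x ∈ semistableLocus n ℓ (detInv n)) :
    ∃ w : Fin n → List (Letter ℓ), (wordMatrix w x).det ≠ 0 := by
  have htop : Submodule.span ℂ (Set.range (wordVec x)) = ⊤ := by
    refine eq_top_of_mem_semistableLocus hx _ (Submodule.subset_span ⟨[], rfl⟩) fun c v hv => ?_
    induction hv using Submodule.span_induction with
    | mem v hv =>
      obtain ⟨w, rfl⟩ := hv
      exact Submodule.subset_span ⟨c :: w, rfl⟩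
    | zero => rw [mulVec_zero]; exact Submodule.zero_mem _
    | add v w _ _ hv hw => rw [mulVec_add]; exact Submodule.add_mem _ hv hw
    | smul z v _ hv => rw [mulVec_smul]; exact Submodule.smul_mem _ _ hv
  obtain ⟨v, hmem, -, hli⟩ := Submodule.exists_fun_fin_finrank_span_eq ℂ (Set.range (wordVec x))
  have hcard : Module.finrank ℂ (Submodule.span ℂ (Set.range (wordVec x))) = n := by
    rw [htop, finrank_top]; simp
  choose w hw using hmem
  refine ⟨fun b => w (Fin.cast hcard.symm b), ?_⟩
  rw [← isUnit_iff_ne_zero, ← isUnit_iff_isUnit_det, ← linearIndependent_cols_iff_isUnit]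
  have hcol : (wordMatrix (fun b => w (Fin.cast hcard.symm b)) x).col =
      v ∘ Fin.cast hcard.symm := by
    funext b a
    simp [wordMatrix, hw]
  rw [hcol]
  exact hli.comp _ (Fin.cast_injective _)

theorem coord_injective : Function.Injective (coord (n := n) (ℓ := ℓ)) := by
  intro x y h
  ext1
  · funext k; ext a b; exact congrFun h (.inl (k, a, b))
  · funext k; ext a b; exact congrFun h (.inr (.inl (k, a, b)))
  · funext a; exact congrFun h (.inr (.inr (.inl a)))
  · funext a; exact congrFun h (.inr (.inr (.inr a)))

/-- The coordinates in a basis of words are quotients of regular functions by the determinant. -/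
theorem exists_regular_normalForm (w : Fin n → List (Letter ℓ)) (a : Coord n ℓ) :
    ∃ F ∈ regularFunctions n ℓ, ∀ (y : CotangentRep n ℓ) (G : GL (Fin n) ℂ),
      G.val = wordMatrix w y → F y = (wordMatrix w y).det * coord (G⁻¹ • y) a := by
  have hadj : ∀ (y : CotangentRep n ℓ) (G : GL (Fin n) ℂ), G.val = wordMatrix w y →
      (wordMatrix w y).adjugate = (wordMatrix w y).det • (G⁻¹).val := fun y G hG => by
    have h : (wordMatrix w y).adjugate * G.val = (wordMatrix w y).det • 1 := by
      rw [hG, adjugate_mul]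
    calc _ = (wordMatrix w y).adjugate * (G.val * (G⁻¹).val) := by rw [Units.mul_inv, mul_one]
      _ = _ := by rw [← mul_assoc, h, smul_mul_assoc, one_mul]
  have hM := wordMatrix_regular (ℓ := ℓ) w
  have hmat : ∀ (c : Letter ℓ) (a b : Fin n), ∃ F ∈ regularFunctions n ℓ,
      ∀ (y : CotangentRep n ℓ) (G : GL (Fin n) ℂ),
        G.val = wordMatrix w y → F y = (wordMatrix w y).det * mat (G⁻¹ • y) c a b := by
    refine fun c a b => ⟨_, mul_matrix_regular (mul_matrix_regular (adjugate_regular hM)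
      (mat_regular c)) hM a b, fun y G hG => ?_⟩
    simp only [mat_gl, inv_inv, hadj y G hG, hG, smul_mul_assoc, Matrix.smul_apply,
      smul_eq_mul]
  rcases a with ⟨k, a, b⟩ | ⟨k, a, b⟩ | a | a
  · exact hmat (.inl k) a b
  · exact hmat (.inr k) a b
  · refine ⟨fun y => (wordMatrix w y).det * (y.i ᵥ* wordMatrix w y) a,
      mul_regular (det_regular hM) ?_, fun y G hG => ?_⟩
    · simp only [vecMul, dotProduct]
      exact sum_regular _ fun b _ => mul_regular (i_regular b) (hM b a)
    · change _ = _ * (y.i ᵥ* (G⁻¹⁻¹).val) a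
      rw [inv_inv, hG]
  · refine ⟨_, mulVec_regular (adjugate_regular hM) j_regular a, fun y G hG => ?_⟩
    change _ = _ * ((G⁻¹).val *ᵥ y.j) a
    rw [hadj y G hG, smul_mulVec, Pi.smul_apply, smul_eq_mul]

/-- Orbits are closed in the semistable locus. -/
theorem exists_smul_eq_of_mem_orbitClosure {x z : CotangentRep n ℓ}
    (hz : z ∈ semistableLocus n ℓ (detInv n)) (h : z ∈ orbitClosure x) :
    ∃ g : GL (Fin n) ℂ, g • x = z := by
  obtain ⟨w, hw⟩ := exists_det_wordMatrix_ne_zero hz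
  have hdet := det_regular (wordMatrix_regular (ℓ := ℓ) w)
  -- A determinant vanishing at `x` would vanish on its whole orbit, hence at `z`.
  have hx : (wordMatrix w x).det ≠ 0 := fun h0 =>
    hw (eq_of_mem_orbitClosure h hdet (const_regular 0) fun g => by
      rw [wordMatrix_gl, det_mul, h0, mul_zero])
  let A := GeneralLinearGroup.mkOfDetNeZero _ hx
  let B := GeneralLinearGroup.mkOfDetNeZero _ hw
  have key : B⁻¹ • z = A⁻¹ • x := coord_injective <| funext fun a => by
    obtain ⟨F, hF, hFy⟩ := exists_regular_normalForm w a
    -- The normal form in the word basis is constant along the orbit of `x`. Multiplied by the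
    -- determinant it is regular, so the identity passes to the closure, and the determinant cancels
    -- at `z`.
    have h1 : F z = (wordMatrix w z).det * coord (A⁻¹ • x) a := by
      refine eq_of_mem_orbitClosure h hF (mul_regular hdet (const_regular _)) fun g => ?_
      rw [hFy _ (g * A) (by rw [wordMatrix_gl]; rfl), _root_.mul_inv_rev, mul_smul, inv_smul_smul]
    rw [hFy z B rfl] at h1
    exact mul_left_cancel₀ hw h1
  exact ⟨B * A⁻¹, by rw [mul_smul, ← key, smul_inv_smul]⟩

/-- The points of the variety are the orbits of semistable points. -/
theorem mk_eq_mk_iff {x y : CotangentRep n ℓ} (hx : x ∈ semistableLocus n ℓ (detInv n))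
    (hy : y ∈ semistableLocus n ℓ (detInv n)) :
    QuiverVariety.mk x hx = QuiverVariety.mk y hy ↔ ∃ g : GL (Fin n) ℂ, g • x = y := by
  constructor
  · intro h
    -- `Quot` identifies points by the equivalence relation generated by `GITRel`; the orbit is
    -- constant on its classes because it is preserved by each generating relation.
    have := congrArg (Quot.lift (fun p : semistableLocus n ℓ (detInv n) =>
      MulAction.orbit (GL (Fin n) ℂ) p.1) ?_) h
    · have hmem : y ∈ MulAction.orbit (GL (Fin n) ℂ) x := by
        rw [show MulAction.orbit (GL (Fin n) ℂ) x = _ from this]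
        exact MulAction.mem_orbit_self y
      exact hmem
    · rintro ⟨p, hp⟩ ⟨q, hq⟩ ⟨z, hz, hpz, hqz⟩
      obtain ⟨g, rfl⟩ := exists_smul_eq_of_mem_orbitClosure hz hpz
      obtain ⟨k, hk⟩ := exists_smul_eq_of_mem_orbitClosure hz hqz
      exact (MulAction.orbit_smul g p).symm.trans
        ((congrArg _ hk.symm).trans (MulAction.orbit_smul k q))
  · rintro ⟨g, rfl⟩
    exact Quot.sound ⟨g • x, hy, gl_mem_orbitClosure x g, fun _ hf => by simpa using hf 1⟩

theorem smul_mk (t : Torus ℓ) {x : CotangentRep n ℓ} (hx : x ∈ semistableLocus n ℓ (detInv n)) :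
    t • QuiverVariety.mk x hx = QuiverVariety.mk (t • x) (torus_mem_semistableLocus t hx) := rfl

end Stability

/-! ### Adapted bases, trees and torus weights. -/

section Adapted

variable {n ℓ : ℕ}

/-- The standard basis is obtained from `j` along the rooted tree in which the vertex `r.succ` is
joined to its parent `par r` by the letter `lab r`. -/
structure IsAdapted (x : CotangentRep (n + 1) ℓ) (par : Fin n → Fin (n + 1))
    (lab : Fin n → Letter ℓ) : Prop where
  par_lt : ∀ r, par r < r.succ
  j_eq : x.j = Pi.single 0 1
  edge : ∀ r, mat x (lab r) *ᵥ Pi.single (par r) 1 = Pi.single r.succ 1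

/-- The point at which the only nonzero matrix entries are the ones that belong to the edges of the
tree, and these are `1`. -/
structure IsTreePoint (x : CotangentRep (n + 1) ℓ) (par : Fin n → Fin (n + 1))
    (lab : Fin n → Letter ℓ) : Prop where
  mat_eq : ∀ c p q, mat x c p q = open Classical in
    if ∃ r, p = Fin.succ r ∧ q = par r ∧ c = lab r then 1 else 0
  i_eq : x.i = 0
  j_eq : x.j = Pi.single 0 1

theorem finite_setOf_isTreePoint :
    {x : CotangentRep (n + 1) ℓ | ∃ par lab, IsTreePoint x par lab}.Finite := by
  have : {x : CotangentRep (n + 1) ℓ | ∃ par lab, IsTreePoint x par lab} =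
      ⋃ (par : Fin n → Fin (n + 1)) (lab : Fin n → Letter ℓ), {x | IsTreePoint x par lab} := by
    ext x; simp
  rw [this]
  refine Set.finite_iUnion fun par => Set.finite_iUnion fun lab => Set.Subsingleton.finite ?_
  intro x hx y hy
  refine ext_mat (fun c => ?_) (hx.i_eq.trans hy.i_eq.symm) (hx.j_eq.trans hy.j_eq.symm)
  ext p q
  rw [hx.mat_eq, hy.mat_eq]

/-- Otherwise the span would be an invariant subspace containing `j`, hence all of `V`, although it
has dimension at most `m < n`. -/
theorem exists_mulVec_notMem_span {x : CotangentRep n ℓ} (hx : x ∈ semistableLocus n ℓ (detInv n))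
    {m : ℕ} (hm : m < n) (v : Fin m → Fin n → ℂ) (hj : x.j ∈ Submodule.span ℂ (Set.range v)) :
    ∃ q c, mat x c *ᵥ v q ∉ Submodule.span ℂ (Set.range v) := by
  by_contra! h
  have htop := eq_top_of_mem_semistableLocus hx _ hj fun c u hu => by
    induction hu using Submodule.span_induction with
    | mem u hu =>
      obtain ⟨q, rfl⟩ := hu
      exact h q c
    | zero => rw [mulVec_zero]; exact Submodule.zero_mem _
    | add v w _ _ hv hw => rw [mulVec_add]; exact Submodule.add_mem _ hv hw
    | smul z v _ hv => rw [mulVec_smul]; exact Submodule.smul_mem _ _ hv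
  have hle := finrank_range_le_card (R := ℂ) v
  rw [Set.finrank, htop, finrank_top, Module.finrank_fin_fun, Fintype.card_fin] at hle
  omega

/-- The basis grows greedily: each new vector is a letter applied to an earlier one and leaves the
span so far. The start `j ≠ 0` holds because otherwise the zero subspace would be invariant and
contain `j`. -/
theorem exists_tree {x : CotangentRep n ℓ} (hx : x ∈ semistableLocus n ℓ (detInv n)) (m : ℕ)
    (hm : m + 1 ≤ n) :
    ∃ (v : Fin (m + 1) → Fin n → ℂ) (par : Fin m → Fin (m + 1)) (lab : Fin m → Letter ℓ),
      LinearIndependent ℂ v ∧ v 0 = x.j ∧ (∀ r, par r < r.succ) ∧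
        ∀ r, v r.succ = mat x (lab r) *ᵥ v (par r) := by
  induction m with
  | zero =>
    refine ⟨fun _ => x.j, Fin.elim0, Fin.elim0, ?_, rfl, fun r => r.elim0, fun r => r.elim0⟩
    refine (linearIndependent_unique_iff (ι := Fin 1)).2 fun h0 => ?_
    have hbot := eq_top_of_mem_semistableLocus hx ⊥ (by rw [h0]; exact Submodule.zero_mem _)
      fun c v hv => by
        rw [(Submodule.mem_bot ℂ).1 hv, mulVec_zero]; exact Submodule.zero_mem _
    have := congrArg (fun W : Submodule ℂ (Fin n → ℂ) => Module.finrank ℂ W) hbot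
    simp at this
    omega
  | succ m ih =>
    obtain ⟨v, par, lab, hli, h0, hlt, hedge⟩ := ih (by omega)
    obtain ⟨q, c, hqc⟩ := exists_mulVec_notMem_span hx hm v
      (h0 ▸ Submodule.subset_span ⟨0, rfl⟩)
    refine ⟨Fin.snoc v (mat x c *ᵥ v q), Fin.snoc (fun r => (par r).castSucc) q.castSucc,
      Fin.snoc lab c, linearIndependent_finSnoc.2 ⟨hli, hqc⟩, ?_, fun r => ?_, fun r => ?_⟩
    · rw [← Fin.castSucc_zero, Fin.snoc_castSucc, h0]
    · induction r using Fin.lastCases with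
      | last => rw [Fin.snoc_last, Fin.succ_last]; exact Fin.castSucc_lt_last q
      | cast r =>
        rw [Fin.snoc_castSucc, ← Fin.castSucc_succ]
        exact Fin.castSucc_lt_castSucc_iff.2 (hlt r)
    · induction r using Fin.lastCases with
      | last => rw [Fin.succ_last]; simp only [Fin.snoc_last, Fin.snoc_castSucc]
      | cast r =>
        rw [← Fin.castSucc_succ]
        simp only [Fin.snoc_castSucc, hedge]

/-- Every semistable orbit contains an adapted point. -/
theorem exists_isAdapted {x : CotangentRep (n + 1) ℓ}
    (hx : x ∈ semistableLocus (n + 1) ℓ (detInv (n + 1))) :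
    ∃ (g : GL (Fin (n + 1)) ℂ) (par : _) (lab : _), IsAdapted (g • x) par lab := by
  obtain ⟨v, par, lab, hli, h0, hlt, hedge⟩ := exists_tree hx n le_rfl
  have hunit : IsUnit (Matrix.of v)ᵀ := by
    rw [← linearIndependent_cols_iff_isUnit]; exact hli
  obtain ⟨G, hG⟩ := hunit
  have hGv : ∀ p, G.val *ᵥ Pi.single p 1 = v p := fun p => by
    rw [hG, mulVec_single_one]; rfl
  have hGinv : ∀ p, (G⁻¹).val *ᵥ v p = Pi.single p 1 := fun p => by
    rw [← hGv, mulVec_mulVec, Units.inv_mul, one_mulVec]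
  refine ⟨G⁻¹, par, lab, hlt, ?_, fun r => ?_⟩
  · rw [j_gl, ← h0, hGinv]
  · rw [mat_gl, inv_inv, ← mulVec_mulVec, hGv, ← mulVec_mulVec, ← hedge, hGinv]

/-- The contribution of the arrows between `q` and `p` to the diagonal entry of `∑ₖ [Xₖ, Yₖ]` at
`p`. -/
noncomputable def edgeSum (x : CotangentRep n ℓ) (p q : Fin n) : ℂ :=
  ∑ c, letterSign c * (mat x c p q * mat x c.swap q p)

/-- Exchanging each `Xₖ` with `Yₖ` reverses the sign, so `edgeSum` behaves as a flow along the edge.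
-/
theorem edgeSum_swap (x : CotangentRep n ℓ) (p q : Fin n) : edgeSum x q p = -edgeSum x p q := by
  rw [edgeSum, edgeSum, ← Finset.sum_neg_distrib, ← (Equiv.sumComm _ _).sum_comp]
  refine Finset.sum_congr rfl fun c _ => ?_
  rw [Equiv.sumComm_apply, letterSign_swap, Sum.swap_swap]
  ring

theorem momentMap_apply_eq (x : CotangentRep n ℓ) (p q : Fin n) :
    momentMap x p q = ∑ c, letterSign c * ∑ s, mat x c p s * mat x c.swap s q - x.j p * x.i q := by
  rw [momentMap_eq, Matrix.sub_apply, Matrix.sum_apply, vecMulVec_apply]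
  simp only [Matrix.smul_apply, mul_apply, smul_eq_mul]

theorem momentMap_apply_self (x : CotangentRep n ℓ) (p : Fin n) :
    momentMap x p p = ∑ q, edgeSum x p q - x.j p * x.i p := by
  rw [momentMap_apply_eq]
  simp only [edgeSum, Finset.mul_sum]
  rw [Finset.sum_comm]

/-- If no arrow enters the root then `i = 0`. -/
theorem i_eq_zero {x : CotangentRep (n + 1) ℓ} (h0 : momentMap x = 0) (hj : x.j = Pi.single 0 1)
    (hrow : ∀ c q, mat x c 0 q = 0) : x.i = 0 := by
  funext q
  have := momentMap_apply_eq x 0 q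
  simpa [h0, hrow, hj] using this

/-- A class is fixed by the torus iff the torus preserves the orbit. -/
theorem mk_mem_fixedPoints_iff {x : CotangentRep n ℓ}
    (hx : x ∈ semistableLocus n ℓ (detInv n)) :
    QuiverVariety.mk x hx ∈ MulAction.fixedPoints (Torus ℓ) (NakajimaVariety n ℓ) ↔
      ∀ t : Torus ℓ, ∃ g : GL (Fin n) ℂ, g • x = t • x := by
  rw [MulAction.mem_fixedPoints]
  refine forall_congr' fun t => ?_
  rw [smul_mk, eq_comm, mk_eq_mk_iff]

/-- The entries of a torus-fixed adapted point respect the weights of the basis vectors. -/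
theorem IsAdapted.weight_eq {x : CotangentRep (n + 1) ℓ} {par : Fin n → Fin (n + 1)}
    {lab : Fin n → Letter ℓ} (hx : IsAdapted x par lab)
    (hfix : ∀ t : Torus ℓ, ∃ g : GL (Fin (n + 1)) ℂ, g • x = t • x)
    {χ : Fin (n + 1) → Torus ℓ → ℂˣ} (χ_zero : χ 0 = 1)
    (χ_succ : ∀ r, χ r.succ = letterChar (lab r) * χ (par r))
    {c : Letter ℓ} {p q : Fin (n + 1)} (h : mat x c p q ≠ 0) : χ p = letterChar c * χ q := by
  funext t
  obtain ⟨g, hg⟩ := hfix t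
  have hcomm : ∀ c, g.val * mat x c = (letterChar c t : ℂ) • (mat x c * g.val) := fun c => by
    rw [← smul_mul_assoc, ← mat_torus, ← hg, mat_gl, mul_assoc _ _ g.val, Units.inv_mul, mul_one]
  -- Up to a scalar, `g` commutes with each letter, and it fixes `j`; so the eigenvector property
  -- spreads from the root to each child.
  have heig : ∀ p, g.val *ᵥ Pi.single p 1 = (χ p t : ℂ) • Pi.single p (1 : ℂ) := by
    intro p
    induction p using WellFoundedLT.induction with
    | ind p ih =>
      induction p using Fin.cases with
      | zero =>
        rw [← hx.j_eq, ← j_gl, hg, χ_zero]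
        exact (one_smul ℂ x.j).symm
      | succ r =>
        rw [← hx.edge, mulVec_mulVec, hcomm, smul_mulVec, ← mulVec_mulVec, ih _ (hx.par_lt r),
          mulVec_smul, smul_smul, χ_succ]
        rfl
  have hdiag : g.val = diagonal fun p => (χ p t : ℂ) := ext_of_mulVec_single fun p => by
    rw [heig, mulVec_single_one, col_diagonal]
    funext s
    by_cases hs : s = p
    · subst hs; simp
    · simp [hs]
  have key := congrFun (congrFun (hcomm c) p) q
  rw [hdiag, diagonal_mul, Matrix.smul_apply, mul_diagonal, smul_eq_mul, mul_comm (mat x c p q),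
    ← mul_assoc] at key
  exact Units.ext (mul_right_cancel₀ h key)

end Adapted

/-! ### Fixed points in dimension at most three. -/

section Classification

variable {n ℓ : ℕ}

section General

variable {x : CotangentRep (n + 1) ℓ} {par : Fin n → Fin (n + 1)} {lab : Fin n → Letter ℓ}
  {χ : Fin (n + 1) → Torus ℓ → ℂˣ}

theorem mat_eq_zero_of_parity
    (hwt : ∀ {c p q}, mat x c p q ≠ 0 → χ p = letterChar c * χ q) {p q : Fin (n + 1)}
    (hpar : χ p (-1) ≠ -χ q (-1)) (c : Letter ℓ) : mat x c p q = 0 := by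
  by_contra h
  refine hpar ?_
  rw [hwt h, Pi.mul_apply, letterChar_neg_one, neg_one_mul]

/-- An adapted point respecting the weights is a tree point as soon as the entries outside the edges
of the tree and the diagonal contributions of the edges vanish. -/
theorem IsAdapted.isTreePoint (hx : IsAdapted x par lab) (h0 : momentMap x = 0)
    (χ_succ : ∀ r, χ r.succ = letterChar (lab r) * χ (par r))
    (hwt : ∀ {c p q}, mat x c p q ≠ 0 → χ p = letterChar c * χ q)
    (hadj : ∀ p q, (∃ r, p = Fin.succ r ∧ q = par r) ∨ (∃ r, q = Fin.succ r ∧ p = par r) ∨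
      ∀ c, mat x c p q = 0)
    (hsum : ∀ r, edgeSum x r.succ (par r) = 0) : IsTreePoint x par lab := by
  -- Along an edge the weights allow a single letter, by injectivity of `letterChar`, and
  -- adaptedness makes its entry `1`.
  have hfwd : ∀ r c, mat x c r.succ (par r) = if c = lab r then 1 else 0 := by
    intro r c
    split_ifs with h
    · have := congrFun (hx.edge r) r.succ
      rw [h]
      simpa using this
    · by_contra hne
      have := hwt hne
      rw [χ_succ] at this
      exact h (letterChar_injective (mul_right_cancel this)).symm
  -- Against an edge only the swapped letter has the right weight, so `edgeSum` reduces to plus or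
  -- minus that single entry.
  have hbwd : ∀ r c, mat x c (par r) r.succ = 0 := by
    intro r c
    by_contra hne
    have h1 := hwt hne
    rw [χ_succ, ← mul_assoc] at h1
    have h2 : letterChar c * letterChar (lab r) = 1 := mul_eq_right.1 h1.symm
    have h3 : c = (lab r).swap := letterChar_injective <| by
      rw [letterChar_swap]; exact eq_inv_of_mul_eq_one_left h2
    have h4 := hsum r
    rw [edgeSum, Finset.sum_eq_single (lab r)] at h4
    · rw [hfwd, if_pos rfl, one_mul, ← h3] at h4
      exact (mul_eq_zero.1 h4).elim (letterSign_ne_zero _) hne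
    · intro d _ hd
      rw [hfwd, if_neg hd, zero_mul, mul_zero]
    · simp
  have hmat : ∀ c p q, mat x c p q = open Classical in
      if ∃ r, p = Fin.succ r ∧ q = par r ∧ c = lab r then 1 else 0 := by
    intro c p q
    split_ifs with h
    · obtain ⟨r, rfl, rfl, rfl⟩ := h
      rw [hfwd, if_pos rfl]
    · rcases hadj p q with ⟨r, rfl, rfl⟩ | ⟨r, rfl, rfl⟩ | hz
      · rw [hfwd, if_neg fun hc => h ⟨r, rfl, rfl, hc⟩]
      · exact hbwd r c
      · exact hz c
  refine ⟨hmat, i_eq_zero h0 hx.j_eq fun c q => ?_, hx.j_eq⟩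
  rw [hmat, if_neg]
  rintro ⟨r, hr, -⟩
  exact Fin.succ_ne_zero r hr.symm

/-- Since `j` is supported at the root, `j i` contributes nothing to the other diagonal entries: the
flow is conserved there. -/
theorem sum_edgeSum_eq_zero (h0 : momentMap x = 0) (hj : x.j = Pi.single 0 1) (r : Fin n) :
    ∑ q, edgeSum x r.succ q = 0 := by
  have := momentMap_apply_self x r.succ
  rw [h0, hj, Pi.single_eq_of_ne (Fin.succ_ne_zero r), zero_mul, sub_zero] at this
  exact this.symm

theorem edgeSum_eq_zero {p q : Fin (n + 1)} (h : ∀ c, mat x c p q = 0) : edgeSum x p q = 0 := by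
  simp [edgeSum, h]

end General

theorem one_ne_neg_one : (1 : ℂˣ) ≠ -1 := fun h => by
  have := congrArg Units.val h
  norm_num at this

/-- In dimension at most three, a torus-fixed adapted point of `μ⁻¹(0)` is a tree point. -/
theorem IsAdapted.isTreePoint_of_fixed (hn : n ≤ 2) {x : CotangentRep (n + 1) ℓ}
    {par : Fin n → Fin (n + 1)} {lab : Fin n → Letter ℓ} (hx : IsAdapted x par lab)
    (h0 : momentMap x = 0) (hfix : ∀ t : Torus ℓ, ∃ g : GL (Fin (n + 1)) ℂ, g • x = t • x) :
    IsTreePoint x par lab := by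
  have hswap := edgeSum_swap x
  have hdiag := sum_edgeSum_eq_zero h0 hx.j_eq
  interval_cases n
  · have hwt := @IsAdapted.weight_eq _ _ _ _ _ hx hfix (fun _ => 1) rfl (fun r => r.elim0)
    refine hx.isTreePoint h0 (χ := fun _ => 1) (fun r => r.elim0) hwt (fun p q => .inr (.inr ?_))
      fun r => r.elim0
    exact mat_eq_zero_of_parity hwt (by simp)
  · have hp0 : par 0 = 0 := Fin.ext (Nat.lt_one_iff.1 (hx.par_lt 0))
    have χ_succ : ∀ r : Fin 1, (![1, letterChar (lab 0)] : Fin 2 → Torus ℓ → ℂˣ) r.succ =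
        letterChar (lab r) * (![1, letterChar (lab 0)] : Fin 2 → Torus ℓ → ℂˣ) (par r) := by
      intro r
      fin_cases r
      simp [hp0]
    have hwt := @IsAdapted.weight_eq _ _ _ _ _ hx hfix ![1, letterChar (lab 0)] rfl χ_succ
    have h00 : ∀ c, mat x c 0 0 = 0 :=
      mat_eq_zero_of_parity hwt (by simp)
    have h11 : ∀ c, mat x c 1 1 = 0 :=
      mat_eq_zero_of_parity hwt (by simp [letterChar_neg_one])
    have e11 := edgeSum_eq_zero h11
    refine hx.isTreePoint h0 χ_succ hwt (fun p q => ?_) fun r => ?_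
    · fin_cases p <;> fin_cases q
      · exact .inr (.inr h00)
      · exact .inr (.inl ⟨0, rfl, hp0.symm⟩)
      · exact .inl ⟨0, rfl, hp0.symm⟩
      · exact .inr (.inr h11)
    · fin_cases r
      have := hdiag 0
      rw [Fin.sum_univ_two] at this
      change edgeSum x 1 (par 0) = 0
      change edgeSum x 1 0 + edgeSum x 1 1 = 0 at this
      rwa [e11, add_zero, ← hp0] at this
  · have hp0 : par 0 = 0 := Fin.ext (Nat.lt_one_iff.1 (hx.par_lt 0))
    have hp1 : par 1 = 0 ∨ par 1 = 1 := by
      have : (par 1).val < 2 := hx.par_lt 1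
      rw [Fin.ext_iff, Fin.ext_iff]
      change (par 1).val = 0 ∨ (par 1).val = 1
      omega
    obtain ⟨ω, hω⟩ : ∃ ω : Fin 3 → Torus ℓ → ℂˣ, ω =
      ![1, letterChar (lab 0), letterChar (lab 1) * ![1, letterChar (lab 0), 1] (par 1)] := ⟨_, rfl⟩
    have χ_zero : ω 0 = 1 := by rw [hω]; rfl
    have χ_succ : ∀ r : Fin 2, ω r.succ = letterChar (lab r) * ω (par r) := by
      intro r
      fin_cases r
      · simp [hω, hp0]
      · rcases hp1 with h | h <;> simp [hω, h]
    have hwt := @IsAdapted.weight_eq _ _ _ _ _ hx hfix ω χ_zero χ_succ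
    have w0 : ω 0 (-1) = 1 := by rw [χ_zero]; rfl
    have w1 : ω 1 (-1) = -1 := by
      rw [show (1 : Fin 3) = Fin.succ 0 from rfl, χ_succ, hp0, Pi.mul_apply, w0,
        letterChar_neg_one, mul_one]
    have w2 : ω 2 (-1) = -ω (par 1) (-1) := by
      rw [show (2 : Fin 3) = Fin.succ 1 from rfl, χ_succ, Pi.mul_apply,
        letterChar_neg_one, neg_one_mul]
    have hpp : ∀ p c, mat x c p p = 0 := fun p => by
      refine mat_eq_zero_of_parity hwt fun h => one_ne_neg_one ?_
      exact mul_right_cancel (b := ω p (-1)) (by rw [one_mul, neg_one_mul]; exact h)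
    have hodd : ∀ p q, ω p (-1) = ω q (-1) → ∀ c, mat x c p q = 0 := fun p q hpq => by
      refine mat_eq_zero_of_parity hwt fun h => one_ne_neg_one ?_
      rw [hpq] at h
      exact mul_right_cancel (b := ω q (-1)) (by rw [one_mul, neg_one_mul]; exact h)
    have e1 : edgeSum x 1 0 + edgeSum x 1 1 + edgeSum x 1 2 = 0 := by
      rw [← hdiag 0, Fin.sum_univ_three]; rfl
    have e2 : edgeSum x 2 0 + edgeSum x 2 1 + edgeSum x 2 2 = 0 := by
      rw [← hdiag 1, Fin.sum_univ_three]; rfl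
    rw [edgeSum_eq_zero (hpp 1), add_zero] at e1
    rw [edgeSum_eq_zero (hpp 2), add_zero] at e2
    rcases hp1 with h | h
    -- Both non-root vertices are leaves attached to the root and have equal parity, so conservation
    -- at each leaf kills its edge.
    · rw [h, w0] at w2
      have e12 := edgeSum_eq_zero (hodd 1 2 (by rw [w1, w2]))
      have e21 := edgeSum_eq_zero (hodd 2 1 (by rw [w1, w2]))
      rw [e12, add_zero] at e1
      rw [e21, add_zero] at e2
      refine hx.isTreePoint h0 χ_succ hwt (fun p q => ?_) fun r => ?_
      · fin_cases p <;> fin_cases q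
        · exact .inr (.inr (hpp 0))
        · exact .inr (.inl ⟨0, rfl, hp0.symm⟩)
        · exact .inr (.inl ⟨1, rfl, h.symm⟩)
        · exact .inl ⟨0, rfl, hp0.symm⟩
        · exact .inr (.inr (hpp 1))
        · exact .inr (.inr (hodd 1 2 (by rw [w1, w2])))
        · exact .inl ⟨1, rfl, h.symm⟩
        · exact .inr (.inr (hodd 2 1 (by rw [w1, w2])))
        · exact .inr (.inr (hpp 2))
      · fin_cases r
        · change edgeSum x 1 (par 0) = 0
          rw [hp0, e1]
        · change edgeSum x 2 (par 1) = 0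
          rw [h, e2]
    -- The tree is the path `0 — 1 — 2`, with ends of equal parity. Conservation at the leaf `2`
    -- kills the outer edge, then conservation at `1` kills the inner one.
    · rw [h, w1, neg_neg] at w2
      have e20 := edgeSum_eq_zero (hodd 2 0 (by rw [w0, w2]))
      rw [e20, zero_add] at e2
      rw [hswap 2 1, e2, neg_zero, add_zero] at e1
      refine hx.isTreePoint h0 χ_succ hwt (fun p q => ?_) fun r => ?_
      · fin_cases p <;> fin_cases q
        · exact .inr (.inr (hpp 0))
        · exact .inr (.inl ⟨0, rfl, hp0.symm⟩)
        · exact .inr (.inr (hodd 0 2 (by rw [w0, w2])))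
        · exact .inl ⟨0, rfl, hp0.symm⟩
        · exact .inr (.inr (hpp 1))
        · exact .inr (.inl ⟨1, rfl, h.symm⟩)
        · exact .inr (.inr (hodd 2 0 (by rw [w0, w2])))
        · exact .inl ⟨1, rfl, h.symm⟩
        · exact .inr (.inr (hpp 2))
      · fin_cases r
        · change edgeSum x 1 (par 0) = 0
          rw [hp0, e1]
        · change edgeSum x 2 (par 1) = 0
          rw [h, e2]

/-- In dimension at most three every fixed point is the class of a tree point. -/
theorem exists_isTreePoint (hn : n ≤ 2) {p : NakajimaVariety (n + 1) ℓ}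
    (hp : p ∈ MulAction.fixedPoints (Torus ℓ) (NakajimaVariety (n + 1) ℓ)) :
    ∃ (x : CotangentRep (n + 1) ℓ) (hx : x ∈ semistableLocus (n + 1) ℓ (detInv (n + 1)))
      (par : _) (lab : _), p = QuiverVariety.mk x hx ∧ (∀ r, par r < Fin.succ r) ∧
        IsTreePoint x par lab := by
  obtain ⟨⟨y, hy⟩, rfl⟩ := Quot.exists_rep p
  obtain ⟨g, par, lab, had⟩ := exists_isAdapted hy
  have hgy := gl_mem_semistableLocus hy g
  have heq : QuiverVariety.mk y hy = QuiverVariety.mk (g • y) hgy := (mk_eq_mk_iff hy hgy).2 ⟨g, rfl⟩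
  refine ⟨g • y, hgy, par, lab, heq, had.par_lt, had.isTreePoint_of_fixed hn hgy.1 ?_⟩
  rw [← mk_mem_fixedPoints_iff hgy, ← heq]
  exact hp

theorem finite_fixedPoints (hn : n ≤ 3) :
    (MulAction.fixedPoints (Torus ℓ) (NakajimaVariety n ℓ)).Finite := by
  rcases n with _ | n
  · have : Subsingleton (CotangentRep 0 ℓ) :=
      ⟨fun x y => ext_mat (fun _ => Subsingleton.elim _ _) (Subsingleton.elim _ _)
        (Subsingleton.elim _ _)⟩
    have : Finite (NakajimaVariety 0 ℓ) :=
      inferInstanceAs (Finite (Quot (GITRel 0 ℓ (detInv 0))))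
    exact Set.toFinite _
  · have hfin : ((Subtype.val : semistableLocus (n + 1) ℓ (detInv (n + 1)) → _) ⁻¹'
        {x | ∃ par lab, IsTreePoint x par lab}).Finite :=
      finite_setOf_isTreePoint.preimage Subtype.val_injective.injOn
    refine (hfin.image fun x => (Quot.mk _ x : NakajimaVariety (n + 1) ℓ)).subset fun p hp => ?_
    obtain ⟨x, hx, par, lab, rfl, -, htree⟩ := exists_isTreePoint (by omega) hp
    exact ⟨⟨x, hx⟩, ⟨par, lab, htree⟩, rfl⟩

/-! ### The fixed points for `n = 2`. -/

/-- The points `pointX s` and `pointY s`, indexed by letters. -/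
noncomputable def letterPoint (c : Letter ℓ) : CotangentRep 2 ℓ := Sum.elim pointX pointY c

theorem mat_letterPoint (c d : Letter ℓ) :
    mat (letterPoint c) d = if d = c then !![0, 0; 1, 0] else 0 := by
  rcases c with c | c <;> rcases d with d | d <;> simp [mat, letterPoint, pointX, pointY]

theorem i_letterPoint (c : Letter ℓ) : (letterPoint c).i = 0 := by
  cases c <;> rfl

theorem j_letterPoint (c : Letter ℓ) : (letterPoint c).j = ![1, 0] := by
  cases c <;> rfl

theorem letterPoint_mem_semistableLocus (c : Letter ℓ) :
    letterPoint c ∈ semistableLocus 2 ℓ (detInv 2) := by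
  refine mem_semistableLocus_of_det_ne_zero ?_ ![[], [c]] ?_
  · rw [momentMap_eq, i_letterPoint, vecMulVec_zero, sub_zero]
    refine Finset.sum_eq_zero fun d _ => ?_
    rw [mat_letterPoint, mat_letterPoint]
    split_ifs <;> ext a b <;> fin_cases a <;> fin_cases b <;> simp
  · rw [det_fin_two]
    simp [wordMatrix, wordVec, j_letterPoint, mat_letterPoint]

theorem letterPoint_mem_fixedPoints (c : Letter ℓ) :
    QuiverVariety.mk (letterPoint c) (letterPoint_mem_semistableLocus c) ∈
      MulAction.fixedPoints (Torus ℓ) (NakajimaVariety 2 ℓ) := by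
  rw [mk_mem_fixedPoints_iff]
  intro t
  let z : ℂˣ := letterChar c t
  -- Conjugation by `diag(1, z)` fixes `e₁` and multiplies `E₂₁` by `z`, which is the effect of `t`
  -- on this point.
  let g : GL (Fin 2) ℂ := ⟨!![1, 0; 0, (z : ℂ)], !![1, 0; 0, ((z⁻¹ : ℂˣ) : ℂ)],
    by simp [one_fin_two], by simp [one_fin_two]⟩
  refine ⟨g, ext_mat (fun d => ?_) ?_ ?_⟩
  · rw [mat_gl, mat_torus, mat_letterPoint]
    split_ifs with h
    · subst h
      change !![1, 0; 0, (z : ℂ)] * _ * !![1, 0; 0, ((z⁻¹ : ℂˣ) : ℂ)] = (z : ℂ) • _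
      ext a b
      fin_cases a <;> fin_cases b <;> simp
    · simp
  · rw [i_gl, i_letterPoint, zero_vecMul]
    exact (i_letterPoint c).symm
  · rw [j_gl, j_letterPoint]
    refine Eq.trans ?_ (j_letterPoint c).symm
    change !![1, 0; 0, (z : ℂ)] *ᵥ _ = _
    ext a
    fin_cases a <;> simp

/-- Simultaneous conjugation cannot change which of the matrices vanish, and `letterPoint c` is
nonzero at `c` only. -/
theorem mk_letterPoint_injective : Function.Injective fun c : Letter ℓ =>
    (QuiverVariety.mk (letterPoint c) (letterPoint_mem_semistableLocus c) :
      NakajimaVariety 2 ℓ) := by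
  intro c d h
  obtain ⟨g, hg⟩ := (mk_eq_mk_iff _ _).1 h
  by_contra hne
  have h1 := congrArg (fun x => mat x d 1 0) hg
  simp [mat_gl, mat_letterPoint, Ne.symm hne] at h1

theorem fixedPoints_eq_range : MulAction.fixedPoints (Torus ℓ) (NakajimaVariety 2 ℓ) =
    Set.range fun c : Letter ℓ =>
      QuiverVariety.mk (letterPoint c) (letterPoint_mem_semistableLocus c) := by
  refine Set.Subset.antisymm (fun p hp => ?_) ?_
  · obtain ⟨x, hx, par, lab, rfl, hlt, htree⟩ := exists_isTreePoint (n := 1) (by omega) hp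
    -- On two vertices the parent is forced, so the tree point depends only on the letter `lab 0`.
    have hp0 : par 0 = 0 := Fin.ext (Nat.lt_one_iff.1 (hlt 0))
    have hxc : letterPoint (lab 0) = x := by
      refine ext_mat (fun c => ?_) ?_ ?_
      · ext p q
        rw [htree.mat_eq, mat_letterPoint]
        fin_cases p <;> fin_cases q <;> by_cases hc : c = lab 0 <;>
          simp [hc, hp0, Fin.exists_fin_one]
      · rw [htree.i_eq, i_letterPoint]
      · rw [htree.j_eq, j_letterPoint]
        ext p
        fin_cases p <;> simp
    subst hxc
    exact ⟨lab 0, rfl⟩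
  · rintro _ ⟨c, rfl⟩
    exact letterPoint_mem_fixedPoints c

end Classification

end BouquetQuiver

theorem mainTheorem8 (ℓ : ℕ) :
    (∀ n : ℕ, n ≤ 3 →
      (MulAction.fixedPoints (BouquetQuiver.Torus ℓ) (BouquetQuiver.NakajimaVariety n ℓ)).Finite) ∧
    (MulAction.fixedPoints (BouquetQuiver.Torus ℓ)
      (BouquetQuiver.NakajimaVariety 2 ℓ)).ncard = 2 * ℓ ∧
    ∃ (hX : ∀ s : Fin ℓ,
          BouquetQuiver.pointX s ∈ BouquetQuiver.semistableLocus 2 ℓ (BouquetQuiver.detInv 2))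
      (hY : ∀ s : Fin ℓ,
          BouquetQuiver.pointY s ∈ BouquetQuiver.semistableLocus 2 ℓ (BouquetQuiver.detInv 2)),
      MulAction.fixedPoints (BouquetQuiver.Torus ℓ) (BouquetQuiver.NakajimaVariety 2 ℓ) =
        Set.range (fun s : Fin ℓ => BouquetQuiver.QuiverVariety.mk (BouquetQuiver.pointX s) (hX s)) ∪
        Set.range (fun s : Fin ℓ => BouquetQuiver.QuiverVariety.mk (BouquetQuiver.pointY s) (hY s)) := by
  refine ⟨fun n hn => BouquetQuiver.finite_fixedPoints hn, ?_,
    fun s => BouquetQuiver.letterPoint_mem_semistableLocus (.inl s),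
    fun s => BouquetQuiver.letterPoint_mem_semistableLocus (.inr s), ?_⟩
  · rw [BouquetQuiver.fixedPoints_eq_range, ← Set.image_univ,
      Set.ncard_image_of_injective _ BouquetQuiver.mk_letterPoint_injective, Set.ncard_univ]
    simp [two_mul]
  · rw [BouquetQuiver.fixedPoints_eq_range]
    ext p
    simp only [Set.mem_union, Set.mem_range, Sum.exists]
    rfl
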